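/- Let $n\ge 1$ and let $\mathcal L^n$ denote the Lebesgue outer measure on $\mathbb{R}^n$. For $E\subset\mathbb{R}^n$ and real $m\ge n$, let $E^{(m)}$ (the set of $m$-density points of $E$) be the set of all $x\in\mathbb{R}^n$ such that $$\lim_{r\to 0^+}\frac{\mathcal L^n(B(x,r)\setminus E)}{r^m}=0,$$ where $B(x,r)$ is the open Euclidean ball of radius $r$ centered at $x$. The density-degree function $d_E:\mathbb{R}^n\to[0,+\infty]$ of $E$ is defined by $d_E(x)=\sup\{m\in[n,+\infty)\mid x\in E^{(m)}\}$ if $x\in E^{(n)}$, and $d_E(x)=0$ if $x\notin E^{(n)}$. **Theorem 5.1.** Let $f:\mathbb{R}^n\to[-\infty,+\infty]$ be a (Lebesgue) measurable function such that $f(x)\in\{0\}\cup[n,+\infty]$ for almost every $x\in\mathbb{R}^n$. Then there exists a sequence $(F_k)_{k=1}^\infty$ of closed subsets of $\mathbb{R}^n$ such that $\lim_{k\to\infty}d_{F_k}(x)=f(x)$ in $[-\infty,+\infty]$ for almost every $x\in\mathbb{R}^n$. -/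

import Mathlib

open MeasureTheory Filter Topology
open scoped ENNReal

noncomputable section

/-- The set `E^(m)` of `m`-density points of an arbitrary subset `E` of `ℝⁿ`: the points `x` with
`ℒⁿ(B(x, r) \ E) / r ^ m → 0` as `r → 0⁺`. On sets that need not be measurable, `volume` is the
Lebesgue outer measure. -/
def densityPoints {n : ℕ} (m : ℝ) (E : Set (EuclideanSpace ℝ (Fin n))) :
    Set (EuclideanSpace ℝ (Fin n)) :=
  {x | Tendsto (fun r : ℝ => volume (Metric.ball x r \ E) / ENNReal.ofReal (r ^ m))
    (𝓝[>] 0) (𝓝 0)}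

open Classical in
/-- The density-degree function `d_E : ℝⁿ → [0, +∞]` of a subset `E` of `ℝⁿ`: the supremum of the
real numbers `m ≥ n` with `x ∈ E^(m)` if `x ∈ E^(n)`, and `0` otherwise. -/
def densityDegree {n : ℕ} (E : Set (EuclideanSpace ℝ (Fin n)))
    (x : EuclideanSpace ℝ (Fin n)) : ℝ≥0∞ :=
  if x ∈ densityPoints (n : ℝ) E then
    sSup (ENNReal.ofReal '' {m : ℝ | (n : ℝ) ≤ m ∧ x ∈ densityPoints m E})
  else 0

end

/-!
For `m > n`, remove from `ℝⁿ` the balls of radius `sᵢ ^ (m / n)` around a maximal `sᵢ`-separated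
set, for each `i` in a tail of a sequence `sᵢ` decreasing to `0` very fast. Every ball
`B(x, 2 * sᵢ)` contains a removed ball of volume comparable to `sᵢ ^ m`, so no point is an
`m`-density point of what is left. By the Borel–Cantelli lemma almost every `x` eventually stays
so far from the nets that `B(x, r)` meets the `i`-th family only if `r` is almost as large as `sᵢ`,
and then the removed volume is of order at most `r ^ k`, for every `k < m`. The remaining closed
set therefore has density degree `m` off a set of small measure.

Since the density degree is local, such sets can be glued along disjoint closed sets that nearly
exhaust the level sets of a simple function, and simple functions approximate `f`.
-/

open Metric

section Nets

lemma exists_isSeparated_isCover_univ (X : Type*) [PseudoMetricSpace X] (s : NNReal) :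
    ∃ P : Set X, IsSeparated s P ∧ IsCover s Set.univ P := by
  obtain ⟨P, hP⟩ := zorn_subset {P : Set X | P ⊆ Set.univ ∧ IsSeparated s P} fun c hc hchain =>
    ⟨⋃₀ c, ⟨Set.subset_univ _, (Set.pairwise_sUnion hchain.directedOn).2 fun t ht => (hc ht).2⟩,
      fun t ht => Set.subset_sUnion_of_mem ht⟩
  exact ⟨P, hP.prop.2, .of_maximal_isSeparated hP⟩

lemma exists_pairwise_lt_dist_forall_exists_dist_le (X : Type*) [PseudoMetricSpace X] {s : ℝ}
    (hs : 0 ≤ s) :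
    ∃ P : Set X, P.Pairwise (s < dist · ·) ∧ ∀ x, ∃ p ∈ P, dist x p ≤ s := by
  lift s to NNReal using hs
  obtain ⟨P, hsep, hcov⟩ := exists_isSeparated_isCover_univ X s
  refine ⟨P, fun p hp q hq hpq => ?_, fun x => ?_⟩
  · have hlt : (s : ℝ≥0∞) < edist p q := hsep hp hq hpq
    rwa [edist_nndist, ENNReal.coe_lt_coe, ← NNReal.coe_lt_coe, coe_nndist] at hlt
  · simpa using isCover_iff_subset_iUnion_closedBall.1 hcov (Set.mem_univ x)

variable {E : Type*} [NormedAddCommGroup E] [NormedSpace ℝ E] [FiniteDimensional ℝ E]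
  [MeasurableSpace E] [BorelSpace E] (μ : Measure E) [μ.IsAddHaarMeasure]

open Module (finrank)

/- Enlarging the balls of radius `s / 2`, which are disjoint, to radius `ρ` multiplies their measure
by `(2 * ρ / s) ^ d`. -/
lemma measure_ball_inter_thickening_le {P : Set E} {s ρ : ℝ} (hs : 0 < s) (hρ : 0 < ρ)
    (hP : P.Pairwise (s < dist · ·)) (x : E) (r : ℝ) :
    μ (ball x r ∩ thickening ρ P) ≤
      ENNReal.ofReal ((2 * ρ / s) ^ finrank ℝ E) * μ (ball x (r + ρ + s / 2)) := by
  set Q : Set E := P ∩ ball x (r + ρ)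
  have hdisj : Q.PairwiseDisjoint (ball · (s / 2)) := fun p hp q hq hpq =>
    ball_disjoint_ball (by linarith [hP hp.1 hq.1 hpq])
  have hQ : Q.Countable := hdisj.countable_of_isOpen (fun _ _ => isOpen_ball)
    fun p _ => ⟨p, mem_ball_self (by positivity)⟩
  have hscale (p : E) :
      μ (ball p ρ) = ENNReal.ofReal ((2 * ρ / s) ^ finrank ℝ E) * μ (ball p (s / 2)) := by
    rw [Measure.addHaar_ball_center μ p (s / 2), ← Measure.addHaar_ball_mul_of_pos μ p
      (by positivity)]
    congr 2
    field_simp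
  have hcover : ball x r ∩ thickening ρ P ⊆ ⋃ p ∈ Q, ball p ρ := by
    rintro y ⟨hyx, hyP⟩
    obtain ⟨p, hp, hyp⟩ := mem_thickening_iff.1 hyP
    refine Set.mem_biUnion ⟨hp, ?_⟩ hyp
    rw [mem_ball] at hyx ⊢
    linarith [dist_triangle_left p x y]
  have hsub : ⋃ p ∈ Q, ball p (s / 2) ⊆ ball x (r + ρ + s / 2) :=
    Set.iUnion₂_subset fun p hp => ball_subset_ball' (by linarith [mem_ball.1 hp.2])
  calc μ (ball x r ∩ thickening ρ P)
      ≤ μ (⋃ p ∈ Q, ball p ρ) := measure_mono hcover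
    _ ≤ ∑' p : Q, μ (ball (p : E) ρ) := measure_biUnion_le μ hQ _
    _ = ENNReal.ofReal ((2 * ρ / s) ^ finrank ℝ E) * μ (⋃ p ∈ Q, ball p (s / 2)) := by
        rw [measure_biUnion hQ hdisj fun _ _ => measurableSet_ball, ← ENNReal.tsum_mul_left]
        simp_rw [hscale]
    _ ≤ _ := by gcongr

lemma ae_eventually_notMem_thickening {P : ℕ → Set E} {s t : ℕ → ℝ} {C : ℝ} (hs : ∀ i, 0 < s i)
    (hsC : ∀ i, s i ≤ C) (ht : ∀ i, 0 < t i) (htC : ∀ i, t i ≤ C)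
    (hP : ∀ i, (P i).Pairwise (s i < dist · ·))
    (hsum : Summable fun i => (2 * t i / s i) ^ finrank ℝ E) :
    ∀ᵐ x ∂μ, ∀ᶠ i in atTop, x ∉ thickening (t i) (P i) := by
  have hball (R : ℕ) : ∀ᵐ x ∂μ, ∀ᶠ i in atTop, x ∉ ball 0 (R : ℝ) ∩ thickening (t i) (P i) := by
    refine ae_eventually_notMem (ne_top_of_le_ne_top
      (ENNReal.mul_ne_top hsum.tsum_ofReal_ne_top
        (measure_ball_lt_top (μ := μ) (x := 0) (r := R + 2 * C)).ne) ?_)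
    rw [← ENNReal.tsum_mul_right]
    refine ENNReal.tsum_le_tsum fun i =>
      (measure_ball_inter_thickening_le μ (hs i) (ht i) (hP i) 0 R).trans ?_
    gcongr _ * μ (ball _ ?_)
    linarith [hs i, hsC i, htC i]
  filter_upwards [ae_all_iff.2 hball] with x hx
  obtain ⟨R, hR⟩ := exists_nat_gt ‖x‖
  filter_upwards [hx R] with i hi hxi using hi ⟨mem_ball_zero_iff.2 hR, hxi⟩

/- With `u = r / a > s`, the left side is at most `6 ^ d * s ^ (m - d) * u ^ d`, and moving
`k - d` powers from `u` down to `s` can only decrease `s ^ (m - k) * u ^ k`. -/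
lemma holes_density_mul_pow_le {d : ℕ} {s a ρ m k r : ℝ} (hs : 0 < s) (ha : 0 < a) (ha1 : a ≤ 1)
    (hρ : 0 < ρ) (hρa : ρ ≤ s * a) (hρm : ρ ^ d ≤ s ^ m) (hk : d ≤ k) (hr : s * a < r) :
    (2 * ρ / s) ^ d * (r + ρ + s / 2) ^ d ≤ 6 ^ d * (s ^ (m - k) * a ^ (-k)) * r ^ k := by
  have hr0 : 0 < r := (mul_pos hs ha).trans hr
  set u := r / a
  have hu : 0 < u := div_pos hr0 ha
  have hsu : s < u := (lt_div_iff₀ ha).2 hr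
  have hru : r ≤ u := le_div_self hr0.le ha ha1
  have hlin : 2 * (r + ρ + s / 2) ≤ 6 * u := by linarith
  have hexchange : u ^ (d : ℝ) * s ^ (k - d) ≤ u ^ k := by
    calc u ^ (d : ℝ) * s ^ (k - d) ≤ u ^ (d : ℝ) * u ^ (k - d) := by
          gcongr
      _ = u ^ k := by rw [← Real.rpow_add hu, add_sub_cancel]
  calc (2 * ρ / s) ^ d * (r + ρ + s / 2) ^ d
      = ρ ^ d * (2 * (r + ρ + s / 2)) ^ d / s ^ d := by
        rw [div_pow, mul_pow, mul_pow]
        ring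
    _ ≤ s ^ m * (6 * u) ^ d / s ^ d := by gcongr
    _ = 6 ^ d * s ^ (m - k) * (u ^ (d : ℝ) * s ^ (k - d)) := by
        rw [mul_pow, Real.rpow_sub hs, Real.rpow_sub hs, Real.rpow_natCast, Real.rpow_natCast]
        field_simp
    _ ≤ 6 ^ d * s ^ (m - k) * u ^ k := by gcongr
    _ = 6 ^ d * (s ^ (m - k) * a ^ (-k)) * r ^ k := by
        rw [Real.div_rpow hr0.le ha.le, Real.rpow_neg ha.le]
        ring

lemma measure_ball_inter_thickening_le_rpow {P : Set E} {s a ρ m k r : ℝ} {x : E} (hs : 0 < s)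
    (ha : 0 < a) (ha1 : a ≤ 1) (hρ : 0 < ρ) (hρa : ρ ≤ s * a)
    (hρm : ρ ^ finrank ℝ E ≤ s ^ m) (hk : finrank ℝ E ≤ k) (hr : 0 < r)
    (hP : P.Pairwise (s < dist · ·)) (hx : x ∉ thickening (2 * (s * a)) P) :
    μ (ball x r ∩ thickening ρ P) ≤
      ENNReal.ofReal (μ.real (ball 0 1) * 6 ^ finrank ℝ E * (s ^ (m - k) * a ^ (-k)) * r ^ k) := by
  rcases le_or_gt r (s * a) with hra | hra
  · have hempty : ball x r ∩ thickening ρ P = ∅ := by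
      refine Set.eq_empty_of_forall_notMem fun y ⟨hyx, hyP⟩ => hx ?_
      obtain ⟨p, hp, hyp⟩ := mem_thickening_iff.1 hyP
      refine mem_thickening_iff.2 ⟨p, hp, ?_⟩
      rw [mem_ball] at hyx
      linarith [dist_triangle_left x p y]
    simp [hempty]
  · refine (measure_ball_inter_thickening_le μ hs hρ hP x r).trans ?_
    rw [Measure.addHaar_ball_of_pos μ x (by positivity), ← ofReal_measureReal,
      ← mul_assoc, ← ENNReal.ofReal_mul (by positivity), ← ENNReal.ofReal_mul (by positivity),
      mul_comm _ (μ.real _), mul_assoc (μ.real _), mul_assoc (μ.real _)]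
    gcongr ENNReal.ofReal (_ * ?_)
    exact holes_density_mul_pow_le hs ha ha1 hρ hρa hρm hk hra

end Nets

section DensityPoints

variable {n : ℕ} {E F : Set (EuclideanSpace ℝ (Fin n))} {x : EuclideanSpace ℝ (Fin n)} {k l m : ℝ}

lemma mem_densityPoints_of_eventually_le {C : ℝ} (hml : m < l)
    (h : ∀ᶠ r in 𝓝[>] 0, volume (ball x r \ E) ≤ ENNReal.ofReal (C * r ^ l)) :
    x ∈ densityPoints m E := by
  have hpow : Tendsto (fun r : ℝ => C * r ^ (l - m)) (𝓝[>] 0) (𝓝 0) := by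
    have hcont : ContinuousAt (fun r : ℝ => C * r ^ (l - m)) 0 :=
      (Real.continuousAt_rpow_const 0 (l - m) (.inr (by linarith))).const_mul C
    simpa [Real.zero_rpow (sub_pos.2 hml).ne'] using hcont.tendsto.mono_left nhdsWithin_le_nhds
  have hlim : Tendsto (fun r : ℝ => ENNReal.ofReal (C * r ^ (l - m))) (𝓝[>] 0) (𝓝 0) := by
    simpa using ENNReal.tendsto_ofReal hpow
  refine tendsto_of_tendsto_of_tendsto_of_le_of_le' tendsto_const_nhds hlim
    (.of_forall fun _ => zero_le) ?_
  filter_upwards [h, self_mem_nhdsWithin] with r hle (hr : 0 < r)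
  have hpos : 0 < r ^ m := Real.rpow_pos_of_pos hr m
  refine ENNReal.div_le_of_le_mul ?_
  rwa [← ENNReal.ofReal_mul' hpos.le, mul_assoc, ← Real.rpow_add hr, sub_add_cancel]

lemma mem_densityPoints_compl_iUnion {V : ℕ → Set (EuclideanSpace ℝ (Fin n))} {c : ℕ → ℝ}
    (hml : m < l) (hc0 : ∀ i, 0 ≤ c i) (hc : Summable c)
    (h : ∀ i, ∀ r > 0, volume (ball x r ∩ V i) ≤ ENNReal.ofReal (c i * r ^ l)) :
    x ∈ densityPoints m (⋃ i, V i)ᶜ := by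
  refine mem_densityPoints_of_eventually_le (C := ∑' i, c i) hml ?_
  filter_upwards [self_mem_nhdsWithin] with r (hr : 0 < r)
  have hrl : 0 ≤ r ^ l := Real.rpow_nonneg hr.le l
  calc volume (ball x r \ (⋃ i, V i)ᶜ)
      = volume (⋃ i, ball x r ∩ V i) :=
        congrArg volume (sdiff_compl.trans (Set.inter_iUnion _ _))
    _ ≤ ∑' i, ENNReal.ofReal (c i * r ^ l) :=
        (measure_iUnion_le _).trans (ENNReal.tsum_le_tsum fun i => h i r hr)
    _ = ENNReal.ofReal ((∑' i, c i) * r ^ l) := by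
        rw [← ENNReal.ofReal_tsum_of_nonneg (fun i => mul_nonneg (hc0 i) hrl) (hc.mul_right _),
          tsum_mul_right]

lemma notMem_densityPoints_of_frequently_ball_subset {c : ℝ} (hc : 0 < c)
    (h : ∃ᶠ r in 𝓝[>] 0, ∃ p, ∃ ρ > 0, c * r ^ m ≤ ρ ^ n ∧ ball p ρ ⊆ ball x r \ E) :
    x ∉ densityPoints m E := by
  intro hx
  set ω := volume (ball (0 : EuclideanSpace ℝ (Fin n)) 1)
  have hcω : 0 < ENNReal.ofReal c * ω :=
    ENNReal.mul_pos (ENNReal.ofReal_pos.2 hc).ne' (measure_ball_pos volume _ one_pos).ne'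
  have hsmall := (show Tendsto _ _ _ from hx).eventually_lt_const hcω
  obtain ⟨r, ⟨p, ρ, hρ, hcρ, hsub⟩, hlt, hr : 0 < r⟩ :=
    (h.and_eventually (hsmall.and self_mem_nhdsWithin)).exists
  refine hlt.not_ge ((ENNReal.le_div_iff_mul_le
    (.inl (by simpa using Real.rpow_pos_of_pos hr m)) (.inl ENNReal.ofReal_ne_top)).2 ?_)
  calc ENNReal.ofReal c * ω * ENNReal.ofReal (r ^ m)
      = ENNReal.ofReal (c * r ^ m) * ω := by rw [ENNReal.ofReal_mul hc.le, mul_right_comm]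
    _ ≤ ENNReal.ofReal (ρ ^ n) * ω := by gcongr
    _ = volume (ball p ρ) := by
        rw [Measure.addHaar_ball_of_pos volume p hρ, finrank_euclideanSpace_fin]
    _ ≤ volume (ball x r \ E) := measure_mono hsub

lemma densityPoints_congr (h : E =ᶠ[𝓝 x] F) (m : ℝ) :
    x ∈ densityPoints m E ↔ x ∈ densityPoints m F := by
  obtain ⟨δ, hδ, hball⟩ := eventually_nhds_iff_ball.1 h
  refine tendsto_congr' ?_
  filter_upwards [Ioo_mem_nhdsGT hδ] with r hr
  congr 2
  ext y
  exact and_congr_right fun hy => not_congr (iff_of_eq (hball y (ball_subset_ball hr.2.le hy)))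

lemma densityDegree_congr (h : E =ᶠ[𝓝 x] F) : densityDegree E x = densityDegree F x := by
  classical exact if_congr (densityPoints_congr h _) (by simp only [densityPoints_congr h]) rfl

lemma densityDegree_empty (x : EuclideanSpace ℝ (Fin n)) : densityDegree ∅ x = 0 := by
  refine if_neg (notMem_densityPoints_of_frequently_ball_subset one_pos (Eventually.frequently ?_))
  filter_upwards [self_mem_nhdsWithin] with r hr
  exact ⟨x, r, hr, by simp, by simp⟩

lemma densityDegree_eq_ofReal (hm : n < m) (hlt : ∀ k : ℝ, n ≤ k → k < m → x ∈ densityPoints k E)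
    (hge : ∀ k : ℝ, m ≤ k → x ∉ densityPoints k E) : densityDegree E x = ENNReal.ofReal m := by
  have hset : {k : ℝ | n ≤ k ∧ x ∈ densityPoints k E} = Set.Ico (n : ℝ) m := by
    ext k
    exact ⟨fun h => ⟨h.1, not_le.1 fun hk => hge k hk h.2⟩, fun h => ⟨h.1, hlt k h.1 h.2⟩⟩
  rw [densityDegree, if_pos (hlt n le_rfl hm), hset,
    ← ENNReal.ofReal_mono.map_csSup_of_continuousAt ENNReal.continuous_ofReal.continuousAt
      (Set.nonempty_Ico.2 hm) bddAbove_Ico, csSup_Ico hm]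

end DensityPoints

section Perforation

variable {n : ℕ} {P : ℕ → Set (EuclideanSpace ℝ (Fin n))} {s a ρ : ℕ → ℝ}
  {x : EuclideanSpace ℝ (Fin n)} {k l m : ℝ}

lemma mem_densityPoints_compl_iUnion_thickening (hs : ∀ i, 0 < s i) (ha : ∀ i, 0 < a i)
    (ha1 : ∀ i, a i ≤ 1) (hρ : ∀ i, 0 < ρ i) (hρa : ∀ i, ρ i ≤ s i * a i)
    (hρm : ∀ i, ρ i ^ n ≤ s i ^ m) (hnl : n ≤ l) (hkl : k < l)
    (hsum : Summable fun i => s i ^ (m - l) * a i ^ (-l))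
    (hP : ∀ i, (P i).Pairwise (s i < dist · ·)) (hx : ∀ i, x ∉ thickening (2 * (s i * a i)) (P i)) :
    x ∈ densityPoints k (⋃ i, thickening (ρ i) (P i))ᶜ := by
  refine mem_densityPoints_compl_iUnion hkl (fun i => ?_) (hsum.mul_left
    (volume.real (ball (0 : EuclideanSpace ℝ (Fin n)) 1) * 6 ^ n)) fun i r hr => ?_
  · have := hs i
    have := ha i
    positivity
  · simpa only [finrank_euclideanSpace_fin] using measure_ball_inter_thickening_le_rpow volume
      (hs i) (ha i) (ha1 i) (hρ i) (hρa i) (by simpa using hρm i) (by simpa using hnl) hr (hP i)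
      (hx i)

lemma notMem_densityPoints_compl_iUnion_thickening (hs : ∀ i, 0 < s i)
    (hs0 : Tendsto s atTop (𝓝 0)) (hρ : ∀ i, 0 < ρ i) (hρs : ∀ i, ρ i ≤ s i)
    (hρm : ∀ i, s i ^ m ≤ ρ i ^ n) (hP : ∀ i, ∃ p ∈ P i, dist x p ≤ s i) :
    x ∉ densityPoints m (⋃ i, thickening (ρ i) (P i))ᶜ := by
  have hr : Tendsto (fun i => 2 * s i) atTop (𝓝[>] 0) :=
    tendsto_nhdsWithin_iff.2 ⟨by simpa using hs0.const_mul 2,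
      .of_forall fun i => mul_pos two_pos (hs i)⟩
  refine notMem_densityPoints_of_frequently_ball_subset (c := (1 / 2) ^ m) (by positivity)
    (hr.frequently (.of_forall fun i => ?_))
  obtain ⟨p, hp, hxp⟩ := hP i
  refine ⟨p, ρ i, hρ i, ?_, fun y hy => ⟨?_, ?_⟩⟩
  · rw [← Real.mul_rpow (by norm_num) (mul_pos two_pos (hs i)).le, one_div,
      inv_mul_cancel_left₀ two_ne_zero]
    exact hρm i
  · rw [mem_ball] at hy ⊢
    linarith [dist_triangle_right y x p, hρs i]
  · exact Set.notMem_compl_iff.2 (Set.mem_iUnion.2 ⟨i, mem_thickening_iff.2 ⟨p, hp, hy⟩⟩)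

/-- The relative margin `aᵢ = 2⁻ⁱ`: around the `i`-th net, of mesh `sᵢ`, the density degree is
controlled at the points whose distance to the net is at least `2 * (sᵢ * aᵢ)`. -/
noncomputable def netMargin (i : ℕ) : ℝ := (1 / 2) ^ i

/-- The mesh `sᵢ = aᵢⁱ = 2^(-i²)` of the `i`-th net. It is smaller than every power of the
margin `aᵢ`, so that losing powers of `aᵢ` does not change the density exponent. -/
noncomputable def netMesh (i : ℕ) : ℝ := netMargin i ^ i

lemma netMargin_pos (i : ℕ) : 0 < netMargin i := by unfold netMargin; positivity

lemma netMargin_le_one (i : ℕ) : netMargin i ≤ 1 := pow_le_one₀ (by norm_num) (by norm_num)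

lemma summable_netMargin : Summable netMargin :=
  summable_geometric_of_lt_one (by norm_num) (by norm_num)

lemma netMesh_pos (i : ℕ) : 0 < netMesh i := pow_pos (netMargin_pos i) i

lemma netMesh_le_one (i : ℕ) : netMesh i ≤ 1 :=
  pow_le_one₀ (netMargin_pos i).le (netMargin_le_one i)

lemma eventually_netMesh_rpow_le_netMargin_rpow {c : ℝ} (hc : 0 < c) (b : ℝ) :
    ∀ᶠ i in atTop, netMesh i ^ c ≤ netMargin i ^ b := by
  filter_upwards [(tendsto_natCast_atTop_atTop.atTop_mul_const hc).eventually_ge_atTop b] with i hi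
  rw [netMesh, ← Real.rpow_natCast, ← Real.rpow_mul (netMargin_pos i).le]
  exact Real.rpow_le_rpow_of_exponent_ge (netMargin_pos i) (netMargin_le_one i) hi

lemma tendsto_netMesh : Tendsto netMesh atTop (𝓝 0) := by
  refine squeeze_zero' (.of_forall fun i => (netMesh_pos i).le) ?_
    summable_netMargin.tendsto_atTop_zero
  simpa using eventually_netMesh_rpow_le_netMargin_rpow one_pos 1

lemma summable_netMesh_rpow_mul_netMargin_rpow {c : ℝ} (hc : 0 < c) (b : ℝ) :
    Summable fun i => netMesh i ^ c * netMargin i ^ b := by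
  refine .of_norm_bounded_eventually_nat summable_netMargin ?_
  filter_upwards [eventually_netMesh_rpow_le_netMargin_rpow hc (1 - b)] with i hi
  have ha := netMargin_pos i
  have hs := netMesh_pos i
  calc ‖netMesh i ^ c * netMargin i ^ b‖
      = netMesh i ^ c * netMargin i ^ b := Real.norm_of_nonneg (by positivity)
    _ ≤ netMargin i ^ (1 - b) * netMargin i ^ b := by gcongr
    _ = netMargin i := by rw [← Real.rpow_add ha, sub_add_cancel, Real.rpow_one]

lemma eventually_netMesh_rpow_le_mul_netMargin {c : ℝ} (hc : 1 < c) :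
    ∀ᶠ i in atTop, netMesh i ^ c ≤ netMesh i * netMargin i := by
  filter_upwards [eventually_netMesh_rpow_le_netMargin_rpow (sub_pos.2 hc) 1] with i hi
  have hs := netMesh_pos i
  calc netMesh i ^ c = netMesh i * netMesh i ^ (c - 1) := by
        rw [← Real.rpow_one_add' hs.le (by linarith), add_sub_cancel]
    _ ≤ netMesh i * netMargin i := by
        gcongr
        simpa using hi

lemma densityDegree_compl_iUnion_thickening_netMesh {j : ℕ} (hn : 1 ≤ n) (hm : n < m)
    (hj : ∀ i ≥ j, netMesh i ^ (m / n) ≤ netMesh i * netMargin i)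
    (hsep : ∀ i, (P i).Pairwise (netMesh i < dist · ·))
    (hnet : ∀ i, ∃ p ∈ P i, dist x p ≤ netMesh i)
    (hx : ∀ i ≥ j, x ∉ thickening (2 * (netMesh i * netMargin i)) (P i)) :
    densityDegree (⋃ i, thickening (netMesh (i + j) ^ (m / n)) (P (i + j)))ᶜ x =
      ENNReal.ofReal m := by
  have hρ (i : ℕ) : 0 < netMesh i ^ (m / n) := Real.rpow_pos_of_pos (netMesh_pos i) _
  have hρm (i : ℕ) : (netMesh i ^ (m / n)) ^ n = netMesh i ^ m := by
    rw [← Real.rpow_mul_natCast (netMesh_pos i).le, div_mul_cancel₀ _ (by positivity)]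
  have hρs (i : ℕ) (hi : j ≤ i) : netMesh i ^ (m / n) ≤ netMesh i :=
    (hj i hi).trans (mul_le_of_le_one_right (netMesh_pos i).le (netMargin_le_one i))
  have hij (i : ℕ) : j ≤ i + j := Nat.le_add_left j i
  refine densityDegree_eq_ofReal hm (fun k hk hkm => ?_) fun k hk => ?_
  · obtain ⟨l, hkl, hlm⟩ := exists_between hkm
    exact mem_densityPoints_compl_iUnion_thickening (fun i => netMesh_pos (i + j))
      (fun i => netMargin_pos (i + j)) (fun _ => netMargin_le_one _) (fun _ => hρ _)
      (fun i => hj _ (hij i)) (fun _ => (hρm _).le) (hk.trans hkl.le) hkl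
      ((summable_nat_add_iff j).2 (summable_netMesh_rpow_mul_netMargin_rpow (sub_pos.2 hlm) (-l)))
      (fun _ => hsep _) (fun i => hx _ (hij i))
  · exact notMem_densityPoints_compl_iUnion_thickening (fun i => netMesh_pos (i + j))
      (tendsto_netMesh.comp (tendsto_add_atTop_nat j)) (fun _ => hρ _) (fun i => hρs _ (hij i))
      (fun _ => (Real.rpow_le_rpow_of_exponent_ge (netMesh_pos _) (netMesh_le_one _) hk).trans
        (hρm _).ge) (fun _ => hnet _)

lemma ae_eventually_notMem_thickening_netMesh (hn : 1 ≤ n)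
    (hsep : ∀ i, (P i).Pairwise (netMesh i < dist · ·)) :
    ∀ᵐ x, ∀ᶠ i in atTop, x ∉ thickening (2 * (netMesh i * netMargin i)) (P i) := by
  have ha := netMargin_pos
  have hs := netMesh_pos
  have hsa (i : ℕ) : netMesh i * netMargin i ≤ 1 :=
    mul_le_one₀ (netMesh_le_one i) (ha i).le (netMargin_le_one i)
  refine ae_eventually_notMem_thickening volume (C := 2) hs
    (fun i => (netMesh_le_one i).trans one_le_two)
    (fun i => mul_pos two_pos (mul_pos (hs i) (ha i))) (fun i => by linarith [hsa i]) hsep ?_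
  refine .of_nonneg_of_le (fun i => ?_) (fun i => ?_) (summable_netMargin.mul_left (4 ^ n))
  · have := ha i
    have := hs i
    positivity
  · calc (2 * (2 * (netMesh i * netMargin i)) / netMesh i) ^ Module.finrank ℝ _
        = 4 ^ n * netMargin i ^ n := by
          rw [finrank_euclideanSpace_fin, ← mul_pow]
          congr 1
          have := (hs i).ne'
          field_simp
          ring
      _ ≤ 4 ^ n * netMargin i := by
          gcongr
          exact pow_le_of_le_one (ha i).le (netMargin_le_one i) (by lia)

end Perforation

section Approximation

lemma eventually_measure_biUnion_ge_le {α : Type*} [MeasurableSpace α] {μ : Measure α}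
    [IsFiniteMeasure μ] {B : ℕ → Set α} (hB : ∀ i, NullMeasurableSet (B i) μ)
    (h : ∀ᵐ x ∂μ, ∀ᶠ i in atTop, x ∉ B i) {ε : ℝ≥0∞} (hε : ε ≠ 0) :
    ∀ᶠ j in atTop, μ (⋃ i ≥ j, B i) ≤ ε := by
  have hanti : Antitone fun j => ⋃ i ≥ j, B i := fun j k hjk =>
    Set.biUnion_subset_biUnion_left fun i hi => hjk.trans hi
  have hmeas (j : ℕ) : NullMeasurableSet (⋃ i ≥ j, B i) μ :=
    .iUnion fun i => .iUnion fun _ => hB i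
  have hnull : μ (⋂ j, ⋃ i ≥ j, B i) = 0 := by
    refine measure_mono_null (fun x hx => ?_) (ae_iff.1 h)
    intro hx'
    obtain ⟨j, hj⟩ := eventually_atTop.1 hx'
    obtain ⟨i, hi, hxi⟩ := Set.mem_iUnion₂.1 (Set.mem_iInter.1 hx j)
    exact hj i hi hxi
  have hlim := tendsto_measure_iInter_atTop hmeas hanti ⟨0, measure_ne_top μ _⟩
  rw [hnull] at hlim
  exact hlim.eventually_le_const (pos_iff_ne_zero.2 hε)

variable {n : ℕ} {μ : Measure (EuclideanSpace ℝ (Fin n))} [IsFiniteMeasure μ] {ε : ℝ≥0∞}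

lemma exists_isClosed_measure_densityDegree_ne_ofReal_le {m : ℝ} (hn : 1 ≤ n) (hm : n < m)
    (hμ : μ ≪ volume) (hε : ε ≠ 0) :
    ∃ G, IsClosed G ∧ μ {x | densityDegree G x ≠ ENNReal.ofReal m} ≤ ε := by
  choose P hsep hnet using fun i =>
    exists_pairwise_lt_dist_forall_exists_dist_le (EuclideanSpace ℝ (Fin n)) (netMesh_pos i).le
  have hn0 : (0 : ℝ) < n := by exact_mod_cast hn
  obtain ⟨j, hμj, hj⟩ := ((eventually_measure_biUnion_ge_le
    (fun i => isOpen_thickening.measurableSet.nullMeasurableSet)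
    (hμ.ae_le (ae_eventually_notMem_thickening_netMesh hn hsep)) hε).and
    (eventually_forall_ge_atTop.2
      (eventually_netMesh_rpow_le_mul_netMargin ((one_lt_div hn0).2 hm)))).exists
  refine ⟨(⋃ i, thickening (netMesh (i + j) ^ (m / n)) (P (i + j)))ᶜ,
    (isOpen_iUnion fun i => isOpen_thickening).isClosed_compl,
    (measure_mono fun x hx => ?_).trans hμj⟩
  by_contra hxj
  simp only [Set.mem_iUnion, not_exists] at hxj
  exact hx (densityDegree_compl_iUnion_thickening_netMesh hn hm hj hsep (hnet · x) hxj)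

lemma exists_isClosed_measure_densityDegree_ne_le {v : ℝ≥0∞} (hn : 1 ≤ n)
    (hv : v = 0 ∨ (n < v ∧ v ≠ ∞)) (hμ : μ ≪ volume) (hε : ε ≠ 0) :
    ∃ G, IsClosed G ∧ μ {x | densityDegree G x ≠ v} ≤ ε := by
  rcases hv with rfl | ⟨hnv, hv⟩
  · exact ⟨∅, isClosed_empty, by simp [densityDegree_empty]⟩
  · have hm : (n : ℝ) < v.toReal := by
      simpa using (ENNReal.toReal_lt_toReal (ENNReal.natCast_ne_top n) hv).2 hnv
    simpa only [ENNReal.ofReal_toReal hv] using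
      exists_isClosed_measure_densityDegree_ne_ofReal_le hn hm hμ hε

lemma exists_isClosed_eventuallyEq_nhdsSet {X ι : Type*} [TopologicalSpace X] [NormalSpace X]
    [Finite ι] {K G : ι → Set X} (hK : ∀ i, IsClosed (K i)) (hG : ∀ i, IsClosed (G i))
    (hd : Pairwise (Function.onFun Disjoint K)) :
    ∃ F, IsClosed F ∧ ∀ i, F =ᶠ[𝓝ˢ (K i)] G i := by
  obtain ⟨V, hV, hVd⟩ := Pairwise.exists_mem_filter_basis_of_disjoint
    (fun i j hij => disjoint_nhdsSet_nhdsSet (hK i) (hK j) (hd hij))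
    fun i => hasBasis_nhdsSet_closure (K i) (hK i)
  refine ⟨⋃ i, closure (V i) ∩ G i,
    isClosed_iUnion_of_finite fun i => isClosed_closure.inter (hG i), fun i => ?_⟩
  filter_upwards [hV i] with x hx
  refine propext ⟨fun hxF => ?_, fun hxG => Set.mem_iUnion.2 ⟨i, subset_closure hx, hxG⟩⟩
  obtain ⟨j, hxj, hxG⟩ := Set.mem_iUnion.1 hxF
  obtain rfl : i = j := hVd.eq (Set.not_disjoint_iff.2 ⟨x, subset_closure hx, hxj⟩)
  exact hxG

lemma exists_isClosed_measure_densityDegree_ne_simpleFunc_le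
    (g : SimpleFunc (EuclideanSpace ℝ (Fin n)) ℝ≥0∞)
    (hg : ∀ v ∈ g.range, ∀ δ ≠ 0, ∃ G, IsClosed G ∧ μ {x | densityDegree G x ≠ v} ≤ δ)
    (hε : ε ≠ 0) : ∃ F, IsClosed F ∧ μ {x | densityDegree F x ≠ g x} ≤ ε := by
  set η : ℝ≥0∞ := ε / (g.range.card * 2 : ℕ)
  have hη : η ≠ 0 := (ENNReal.div_pos hε (ENNReal.natCast_ne_top _)).ne'
  choose G hG hGη using fun v : g.range => hg v v.2 η hη
  choose K hKg hK hKη using fun v : g.range =>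
    (g.measurableSet_fiber v).exists_isClosed_sdiff_lt (measure_ne_top μ _) hη
  have hd : Pairwise (Function.onFun Disjoint K) := fun v w hvw =>
    Set.disjoint_left.2 fun x hv hw => hvw (Subtype.ext ((hKg v hv).symm.trans (hKg w hw)))
  obtain ⟨F, hF, hFG⟩ := exists_isClosed_eventuallyEq_nhdsSet hK hG hd
  have hsub : {x | densityDegree F x ≠ g x} ⊆
      ⋃ v : g.range, {x | densityDegree (G v) x ≠ v} ∪ g ⁻¹' {↑v} \ K v := by
    intro x hx
    set v : g.range := ⟨g x, g.mem_range_self x⟩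
    refine Set.mem_iUnion.2 ⟨v, or_iff_not_imp_right.2 fun hxgK hxG => hx ?_⟩
    have hxK : x ∈ K v := not_not.1 fun h => hxgK ⟨rfl, h⟩
    rw [densityDegree_congr ((hFG v).filter_mono (nhds_le_nhdsSet hxK)), hxG]
  refine ⟨F, hF, (measure_mono hsub).trans ?_⟩
  calc μ (⋃ v : g.range, {x | densityDegree (G v) x ≠ v} ∪ g ⁻¹' {↑v} \ K v)
      ≤ ∑ _ : g.range, (η + η) := (measure_iUnion_fintype_le _ _).trans <|
        Finset.sum_le_sum fun v _ =>
          (measure_union_le _ _).trans (add_le_add (hGη v) (hKη v).le)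
    _ = (g.range.card * 2 : ℕ) * η := by
        rw [Finset.sum_const, Finset.card_univ, Fintype.card_coe, nsmul_eq_mul]
        push_cast
        ring
    _ ≤ ε := ENNReal.mul_div_le

lemma exists_simpleFunc_tendsto {α : Type*} [MeasurableSpace α] {φ : α → ℝ≥0∞} {b : ℝ≥0∞}
    (hφ : Measurable φ) (hb : b ≠ ∞) (hφb : ∀ x, φ x = 0 ∨ b ≤ φ x) :
    ∃ g : ℕ → SimpleFunc α ℝ≥0∞, (∀ k x, g k x = 0 ∨ (b < g k x ∧ g k x ≠ ∞)) ∧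
      ∀ x, Tendsto (fun k => g k x) atTop (𝓝 (φ x)) := by
  have hzero : MeasurableSet {x | φ x = 0} := hφ (measurableSet_singleton 0)
  have hinv : Tendsto (fun k : ℕ => ((k : ℝ≥0∞) + 1)⁻¹) atTop (𝓝 0) := by
    simpa [Function.comp_def] using
      ENNReal.tendsto_inv_nat_nhds_zero.comp (tendsto_add_atTop_nat 1)
  refine ⟨fun k => .piecewise _ hzero 0
    ((SimpleFunc.eapprox φ k).map fun v => max v b + ((k : ℝ≥0∞) + 1)⁻¹),
    fun k x => ?_, fun x => ?_⟩
  · have hmax : max (SimpleFunc.eapprox φ k x) b ≠ ∞ :=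
      (max_lt (SimpleFunc.eapprox_lt_top φ k x) hb.lt_top).ne
    by_cases hx : φ x = 0
    · exact .inl (by simp [SimpleFunc.piecewise_apply, hx])
    · right
      simp only [SimpleFunc.piecewise_apply, Set.mem_ofPred_eq, hx, if_false, SimpleFunc.map_apply]
      exact ⟨(le_max_right _ _).trans_lt (ENNReal.lt_add_right hmax (by simp)),
        ENNReal.add_ne_top.2 ⟨hmax, by simp⟩⟩
  · by_cases hx : φ x = 0
    · simp [SimpleFunc.piecewise_apply, hx]
    · simp only [SimpleFunc.piecewise_apply, Set.mem_ofPred_eq, hx, if_false, SimpleFunc.map_apply]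
      have hlim := ((SimpleFunc.tendsto_eapprox hφ x).max (tendsto_const_nhds (x := b))).add hinv
      rwa [max_eq_left ((hφb x).resolve_left hx), add_zero] at hlim

lemma exists_measurable_ennreal_ae_eq {α : Type*} [MeasurableSpace α] {μ : Measure α}
    {f : α → EReal} {b : ℝ≥0∞} (hf : AEMeasurable f μ)
    (hval : ∀ᵐ x ∂μ, f x ∈ ({0} ∪ Set.Icc (b : EReal) ⊤ : Set EReal)) :
    ∃ φ : α → ℝ≥0∞, Measurable φ ∧ (∀ x, φ x = 0 ∨ b ≤ φ x) ∧ f =ᵐ[μ] fun x => (φ x : EReal) := by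
  obtain ⟨h, hh, hrange, hfh⟩ := hf.exists_ae_eq_range_subset hval ⟨0, .inl rfl⟩
  have hmem (x : α) : h x = 0 ∨ (b : EReal) ≤ h x :=
    (hrange (Set.mem_range_self x)).imp id And.left
  refine ⟨fun x => (h x).toENNReal, hh.ereal_toENNReal, fun x => (hmem x).imp ?_ ?_, ?_⟩
  · intro hx
    simp [hx]
  · intro hx
    simpa using EReal.toENNReal_le_toENNReal hx
  · filter_upwards [hfh] with x hx
    have h0 : 0 ≤ h x := (hmem x).elim Eq.ge (EReal.coe_ennreal_nonneg b).trans
    rw [hx, EReal.coe_toENNReal h0]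

end Approximation

theorem theorem5p1 (n : ℕ) (hn : 1 ≤ n) (f : EuclideanSpace ℝ (Fin n) → EReal)
    (hf : NullMeasurable f (volume : Measure (EuclideanSpace ℝ (Fin n))))
    (hval : ∀ᵐ x ∂(volume : Measure (EuclideanSpace ℝ (Fin n))),
      f x ∈ ({0} ∪ Set.Icc (n : EReal) ⊤ : Set EReal)) :
    ∃ F : ℕ → Set (EuclideanSpace ℝ (Fin n)),
      (∀ k, IsClosed (F k)) ∧
      ∀ᵐ x ∂(volume : Measure (EuclideanSpace ℝ (Fin n))),
        Tendsto (fun k => ((densityDegree (F k) x : ℝ≥0∞) : EReal)) atTop (𝓝 (f x)) := by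
  obtain ⟨φ, hφ, hφn, hfφ⟩ := exists_measurable_ennreal_ae_eq (b := n) hf.aemeasurable hval
  obtain ⟨g, hg, hgφ⟩ := exists_simpleFunc_tendsto hφ (ENNReal.natCast_ne_top n) hφn
  set μ : Measure (EuclideanSpace ℝ (Fin n)) := volume.toFinite
  have hμ : μ ≪ volume := toFinite_absolutelyContinuous volume
  have happrox (k : ℕ) : ∃ F, IsClosed F ∧ μ {x | densityDegree F x ≠ g k x} ≤ (1 / 2) ^ k := by
    refine exists_isClosed_measure_densityDegree_ne_simpleFunc_le (g k) (fun v hv δ hδ => ?_)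
      (pow_ne_zero k (by simp))
    obtain ⟨x, rfl⟩ := SimpleFunc.mem_range.1 hv
    exact exists_isClosed_measure_densityDegree_ne_le hn (hg k x) hμ hδ
  choose F hF hFμ using happrox
  have hsum : ∑' k, μ {x | densityDegree (F k) x ≠ g k x} ≠ ∞ := by
    refine ne_top_of_le_ne_top ?_ (ENNReal.tsum_le_tsum hFμ)
    simp [ENNReal.tsum_geometric]
  refine ⟨F, hF, ?_⟩
  filter_upwards [hfφ,
    (absolutelyContinuous_toFinite volume).ae_le (ae_eventually_notMem hsum)] with x hfx hx
  rw [hfx]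
  exact (continuous_coe_ennreal_ereal.tendsto _).comp
    ((hgφ x).congr' (hx.mono fun k hk => (not_not.1 hk).symm))
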